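/- Let $n\ge 0$ and let $p$ be a uniformly random permutation in $S_n$, viewed as the list $M_0=[p_1,\dots,p_n]$. A Disappear-Sort (DS) pass scans a list from left to right, removes its records (the entries larger than all earlier entries of the list; the first entry is always a record) and leaves the list of the remaining, discarded entries in their original order. Let $M_{t+1}$ be the list of entries discarded by a DS pass on $M_t$, and let $D_n=\min\{t\ge 0: M_t \text{ is empty}\}$ be the number of passes of this (non-resampling) procedure. Let $\Lambda_n\vdash n$ be the shape of the Young tableau that the Robinson--Schensted correspondence (row insertion) assigns to $p$. For a partition $\lambda\vdash n$, let $\lambda_1'$ be the length of the first column of its Young diagram and $f^\lambda$ the number of standard Young tableaux of shape $\lambda$. Then $\Lambda_n$ has the Plancherel distribution, $\mathbb{P}(\Lambda_n=\lambda)=(f^\lambda)^2/n!$ for every $\lambda\vdash n$, and $$\mathbb{E}[D_n]=\sum_{\lambda\vdash n}\lambda_1'\,\mathbb{P}(\Lambda_n=\lambda)=\sum_{\lambda\vdash n}\lambda_1'\,\frac{(f^\lambda)^2}{n!}=\mathbb{E}[(\Lambda_n)_1'],$$ where $(\Lambda_n)'_1$ is the first-column length of $\Lambda_n$. In particular, $\mathbb{E}[D_n]$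 is the expected first-column length of a Plancherel-random Young diagram with $n$ cells. -/

import Mathlib

open MeasureTheory ProbabilityTheory

/-! ### The non-resampling Disappear-Sort procedure -/

section DisappearSort

variable {α : Type*} [LinearOrder α]

/-- The entries that a pass discards from a list when the current running maximum is `m`:
an entry above the running maximum is kept (it is a record, and becomes the running maximum),
every other entry is discarded. The order of the discarded entries is preserved. -/
def dsDiscardAux (m : α) : List α → List α
  | [] => []
  | x :: xs => if m < x then dsDiscardAux x xs else x :: dsDiscardAux m xs

/-- One Disappear-Sort pass: the list of discarded entries (the non-records) of a list.
The first entry is always a record. -/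
def dsDiscard : List α → List α
  | [] => []
  | x :: xs => dsDiscardAux x xs

/-- The number of passes needed to eliminate the list `l`: the least `t` such that
the list `M_t` is empty, where `M_0 = l` and `M_{t+1}` is the discard list of `M_t`. -/
noncomputable def dsPasses (l : List α) : ℕ :=
  sInf {t : ℕ | dsDiscard^[t] l = []}

theorem length_dsDiscardAux_le (m : α) (l : List α) : (dsDiscardAux m l).length ≤ l.length := by
  induction l generalizing m with
  | nil => simp [dsDiscardAux]
  | cons x xs ih =>
    have h1 := ih x
    have h2 := ih m
    simp only [dsDiscardAux]
    split_ifs <;> simp <;> omega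

/-- The procedure terminates, so that `dsPasses` is a genuine minimum. -/
theorem dsPasses_spec (l : List α) : dsDiscard^[dsPasses l] l = [] := by
  have key : ∀ (t : ℕ) (l : List α), l.length ≤ t → dsDiscard^[t] l = [] := by
    intro t
    induction t with
    | zero => intro l hl; simpa using hl
    | succ t ih =>
      intro l hl
      rw [Function.iterate_succ_apply]
      apply ih
      cases l with
      | nil => simp [dsDiscard]
      | cons x xs =>
        have := length_dsDiscardAux_le x xs
        simp only [dsDiscard, List.length_cons] at *
        omega
  exact Nat.sInf_mem (s := {t : ℕ | dsDiscard^[t] l = []}) ⟨l.length, key _ l le_rfl⟩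

end DisappearSort

/-! ### The Robinson-Schensted tableau of a list -/

section RobinsonSchensted

variable {α : Type*} [LinearOrder α]

/-- Schensted insertion of `x` into one row: `x` replaces the leftmost entry larger than `x`,
which is bumped out; if there is none, then `x` is appended and nothing is bumped. -/
def rowInsert (x : α) : List α → List α × Option α
  | [] => ([x], none)
  | y :: ys => if x < y then (x :: ys, some y) else (y :: (rowInsert x ys).1, (rowInsert x ys).2)

/-- Row insertion of `x` into a tableau, given as the list of its rows from top to bottom:
the entry bumped out of a row is inserted into the next one. -/
def tableauInsert (x : α) : List (List α) → List (List α)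
  | [] => [[x]]
  | r :: rs =>
    match (rowInsert x r).2 with
    | none => (rowInsert x r).1 :: rs
    | some y => (rowInsert x r).1 :: tableauInsert y rs

/-- The Robinson-Schensted insertion tableau of a list: its entries are inserted
successively, from left to right, into the empty tableau. -/
def rsTableau (l : List α) : List (List α) :=
  l.foldl (fun T x => tableauInsert x T) []

theorem length_rowInsert (x : α) (r : List α) :
    (rowInsert x r).1.length = r.length + if (rowInsert x r).2.isNone then 1 else 0 := by
  induction r with
  | nil => simp [rowInsert]
  | cons y ys ih =>
    simp only [rowInsert]
    split_ifs at * <;> simp_all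

theorem sum_length_tableauInsert (x : α) (T : List (List α)) :
    ((tableauInsert x T).map List.length).sum = (T.map List.length).sum + 1 := by
  induction T generalizing x with
  | nil => simp [tableauInsert]
  | cons r rs ih =>
    have h := length_rowInsert x r
    rw [tableauInsert]
    split <;> rename_i h' <;> simp [h'] at h <;> simp [h, ih] <;> omega

theorem sum_length_rsTableau (l : List α) :
    ((rsTableau l).map List.length).sum = l.length := by
  have key : ∀ (l : List α) (T : List (List α)),
      ((l.foldl (fun T x => tableauInsert x T) T).map List.length).sum
        = (T.map List.length).sum + l.length := by
    intro l
    induction l with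
    | nil => simp
    | cons x xs ih =>
      intro T
      rw [List.foldl_cons, ih, sum_length_tableauInsert, List.length_cons]
      omega
  simpa [rsTableau] using key l []

end RobinsonSchensted

/-! ### Permutations -/

/-- The one-line notation `[p 0, p 1, …, p (n - 1)]` of a permutation. -/
def oneLine {n : ℕ} (p : Equiv.Perm (Fin n)) : List (Fin n) :=
  List.ofFn p

/-- The Robinson-Schensted shape of a permutation: the partition of `n` whose parts are the
row lengths of the insertion tableau of its one-line notation (these decrease weakly). -/
def rsShape {n : ℕ} (p : Equiv.Perm (Fin n)) : n.Partition :=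
  Nat.Partition.ofSums n ((rsTableau (oneLine p)).map List.length : List ℕ)
    (by simpa [oneLine] using sum_length_rsTableau (oneLine p))

/-! ### Partitions, Young diagrams and standard Young tableaux -/

/-- The Young diagram of a partition: its row lengths are the parts in decreasing order. -/
def Nat.Partition.youngDiagram {n : ℕ} (lam : n.Partition) : YoungDiagram :=
  YoungDiagram.ofRowLens (lam.parts.sort (· ≥ ·)) (Multiset.pairwise_sort _ _).sortedGE

/-- The length `λ'₁` of the first column of the Young diagram of a partition. -/
def Nat.Partition.firstColumn {n : ℕ} (lam : n.Partition) : ℕ :=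
  lam.youngDiagram.colLen 0

/-- The standard Young tableaux of shape `D`: the semistandard ones in which each of
`1, …, |D|` occurs in exactly one cell (so that the rows, too, increase strictly). -/
def StandardYoungTableau (D : YoungDiagram) : Type :=
  {T : SemistandardYoungTableau D //
    Set.BijOn (fun c : ℕ × ℕ => T c.1 c.2) (D.cells : Set (ℕ × ℕ)) (Set.Icc 1 D.card)}

/-- The number `f^λ` of standard Young tableaux of shape `λ`. -/
noncomputable def Nat.Partition.numSYT {n : ℕ} (lam : n.Partition) : ℕ :=
  Nat.card (StandardYoungTableau lam.youngDiagram)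

/-! ### The two probability measures -/

/-- Every subset of the finite set of permutations of `Fin n` is an event. -/
instance instMeasurableSpacePermFin (n : ℕ) : MeasurableSpace (Equiv.Perm (Fin n)) := ⊤

/-- Every subset of the finite set of partitions of `n` is an event. -/
instance instMeasurableSpaceNatPartition (n : ℕ) : MeasurableSpace n.Partition := ⊤

/-- The uniform probability measure on the permutations of `Fin n`. -/
noncomputable def uniformPerm (n : ℕ) : Measure (Equiv.Perm (Fin n)) :=
  (PMF.uniformOfFintype (Equiv.Perm (Fin n))).toMeasure

/-- The Plancherel measure on the partitions of `n`, with mass `(f^λ)² / n!` at `λ`. -/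
noncomputable def plancherel (n : ℕ) : Measure n.Partition :=
  ∑ lam : n.Partition, ENNReal.ofReal ((lam.numSYT : ℝ) ^ 2 / (n.factorial : ℝ)) • Measure.dirac lam

/-! ### Passes and decreasing sublists -/

section DecreasingSublists

open scoped List

variable {α : Type*} [LinearOrder α]

theorem dsDiscardAux_sublist (m : α) (l : List α) : dsDiscardAux m l <+ l := by
  induction l generalizing m with
  | nil => simp [dsDiscardAux]
  | cons x xs ih =>
    simp only [dsDiscardAux]
    split_ifs
    · exact (ih x).cons x
    · exact (ih m).cons_cons x

theorem dsDiscard_sublist (l : List α) : dsDiscard l <+ l := by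
  cases l with
  | nil => simp [dsDiscard]
  | cons x xs => exact (dsDiscardAux_sublist x xs).cons x

theorem tail_sublist_dsDiscardAux {m : α} {l s : List α} (hs : s <+ m :: l)
    (hd : s.Pairwise (· > ·)) : s.tail <+ dsDiscardAux m l := by
  induction l generalizing m s with
  | nil =>
    rcases List.sublist_cons_iff.1 hs with h | ⟨r, rfl, h⟩ <;> simp_all [dsDiscardAux]
  | cons x xs ih =>
    simp only [dsDiscardAux]
    split_ifs with hmx
    · rcases List.sublist_cons_iff.1 hs with h | ⟨r, rfl, h⟩
      · exact ih h hd
      · rw [List.pairwise_cons] at hd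
        rcases List.sublist_cons_iff.1 h with h' | ⟨q, rfl, h'⟩
        · refine ih (s := x :: r) (h'.cons_cons x) (List.pairwise_cons.2 ⟨fun a ha => ?_, hd.2⟩)
          exact (hd.1 a ha).trans hmx
        · exact absurd (hd.1 x (by simp)) (not_lt.2 hmx.le)
    · rcases List.sublist_cons_iff.1 hs with h | ⟨r, rfl, h⟩
      · rcases List.sublist_cons_iff.1 h with h' | ⟨q, rfl, h'⟩
        · exact (ih (h'.cons m) hd).cons x
        · rw [List.pairwise_cons] at hd
          refine (ih (s := m :: q) (h'.cons_cons m)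
            (List.pairwise_cons.2 ⟨fun a ha => ?_, hd.2⟩)).cons x
          exact lt_of_lt_of_le (hd.1 a ha) (not_lt.1 hmx)
      · rcases List.sublist_cons_iff.1 h with h' | ⟨q, rfl, h'⟩
        · exact (ih (h'.cons_cons m) hd).cons x
        · exact (ih (s := m :: q) (h'.cons_cons m)
            (hd.sublist ((List.sublist_cons_self x q).cons_cons m))).cons_cons x

theorem tail_sublist_dsDiscard {l s : List α} (hs : s <+ l) (hd : s.Pairwise (· > ·)) :
    s.tail <+ dsDiscard l := by
  cases l with
  | nil => simp_all [dsDiscard]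
  | cons x xs => exact tail_sublist_dsDiscardAux hs hd

theorem drop_sublist_iterate_dsDiscard (t : ℕ) {l s : List α} (hs : s <+ l)
    (hd : s.Pairwise (· > ·)) : s.drop t <+ dsDiscard^[t] l := by
  induction t generalizing l s with
  | zero => simpa
  | succ t ih =>
    rw [Function.iterate_succ_apply, ← List.drop_tail]
    exact ih (tail_sublist_dsDiscard hs hd) (hd.sublist (List.tail_sublist s))

theorem length_le_dsPasses {l s : List α} (hs : s <+ l) (hd : s.Pairwise (· > ·)) :
    s.length ≤ dsPasses l := by
  have h := drop_sublist_iterate_dsDiscard (dsPasses l) hs hd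
  rw [dsPasses_spec, List.sublist_nil, List.drop_eq_nil_iff] at h
  exact h

theorem exists_cons_sublist_of_sublist_dsDiscardAux {m y : α} {l s : List α}
    (hs : y :: s <+ dsDiscardAux m l) : ∃ z, y ≤ z ∧ z :: y :: s <+ m :: l := by
  induction l generalizing m y s with
  | nil => simp [dsDiscardAux] at hs
  | cons x xs ih =>
    simp only [dsDiscardAux] at hs
    split_ifs at hs with hmx
    · obtain ⟨z, hz, h⟩ := ih hs
      exact ⟨z, hz, h.cons m⟩
    · rcases List.sublist_cons_iff.1 hs with h | ⟨r, hr, h⟩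
      · obtain ⟨z, hz, h⟩ := ih h
        exact ⟨z, hz, h.trans ((List.sublist_cons_self x xs).cons_cons m)⟩
      · obtain ⟨rfl, rfl⟩ := List.cons.inj hr
        exact ⟨m, not_lt.1 hmx, ((h.trans (dsDiscardAux_sublist m xs)).cons_cons y).cons_cons m⟩

theorem exists_cons_sublist_of_sublist_dsDiscard {y : α} {l s : List α} (hl : l.Nodup)
    (hs : y :: s <+ dsDiscard l) : ∃ z, y < z ∧ z :: y :: s <+ l := by
  cases l with
  | nil => simp [dsDiscard] at hs
  | cons x xs =>
    obtain ⟨z, hz, h⟩ := exists_cons_sublist_of_sublist_dsDiscardAux hs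
    have hne := (List.nodup_cons.1 (hl.sublist h)).1
    exact ⟨z, lt_of_le_of_ne hz (by rintro rfl; simp at hne), h⟩

theorem exists_decreasing_sublist_of_iterate_dsDiscard_ne_nil (t : ℕ) {l : List α} (hl : l.Nodup)
    (h : dsDiscard^[t] l ≠ []) : ∃ s, s <+ l ∧ s.Pairwise (· > ·) ∧ s.length = t + 1 := by
  induction t generalizing l with
  | zero =>
    cases l with
    | nil => simp at h
    | cons x xs => exact ⟨[x], by simp, by simp, rfl⟩
  | succ t ih =>
    obtain ⟨s, hs, hd, hlen⟩ := ih (hl.sublist (dsDiscard_sublist l)) h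
    cases s with
    | nil => simp at hlen
    | cons y s =>
      obtain ⟨z, hz, hzs⟩ := exists_cons_sublist_of_sublist_dsDiscard hl hs
      refine ⟨z :: y :: s, hzs, ?_, by simpa using hlen⟩
      refine List.pairwise_cons.2 ⟨fun a ha => ?_, hd⟩
      rcases List.mem_cons.1 ha with rfl | ha
      · exact hz
      · exact ((List.pairwise_cons.1 hd).1 a ha).trans hz

theorem exists_decreasing_sublist_length_eq_dsPasses {l : List α} (hl : l.Nodup) :
    ∃ s, s <+ l ∧ s.Pairwise (· > ·) ∧ s.length = dsPasses l := by
  rcases h : dsPasses l with _ | t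
  · exact ⟨[], by simp, by simp, rfl⟩
  · refine exists_decreasing_sublist_of_iterate_dsDiscard_ne_nil t hl fun h0 => ?_
    have : dsPasses l ≤ t := Nat.sInf_le h0
    omega

end DecreasingSublists

/-! ### Semistandard tableaux as lists of rows -/

section Tableaux

open scoped List

variable {α : Type*} [LinearOrder α]

/-- The row `s` may stand directly below the row `r`: it is not longer, and each of its entries
is larger than the entry above it. -/
def ColumnsLT : List α → List α → Prop
  | _, [] => True
  | [], _ :: _ => False
  | a :: r, b :: s => a < b ∧ ColumnsLT r s

/-- Lists of nonempty rows that increase weakly, with strictly increasing columns. -/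
def IsTableau : List (List α) → Prop
  | [] => True
  | r :: rs => r ≠ [] ∧ r.Pairwise (· ≤ ·) ∧ ColumnsLT r (rs.headD []) ∧ IsTableau rs

theorem rowInsert_perm (x : α) (r : List α) :
    (rowInsert x r).2.toList ++ (rowInsert x r).1 ~ x :: r := by
  induction r with
  | nil => simp [rowInsert]
  | cons a r ih =>
    simp only [rowInsert]
    split_ifs
    · exact List.Perm.swap _ _ _
    · exact List.perm_middle.trans ((ih.cons a).trans (List.Perm.swap _ _ _))

theorem mem_rowInsert_self (x : α) (r : List α) : x ∈ (rowInsert x r).1 := by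
  induction r with
  | nil => simp [rowInsert]
  | cons a r ih => simp only [rowInsert]; split_ifs <;> simp [ih]

theorem lt_of_rowInsert_eq_some {x y : α} {r : List α} (h : (rowInsert x r).2 = some y) :
    x < y := by
  induction r with
  | nil => simp [rowInsert] at h
  | cons a r ih => simp only [rowInsert] at h; split_ifs at h; all_goals simp_all

theorem mem_of_mem_rowInsert {x z : α} {r : List α} (h : z ∈ (rowInsert x r).1) :
    z = x ∨ z ∈ r :=
  List.mem_cons.1 ((rowInsert_perm x r).subset (List.mem_append_right _ h))

theorem rowInsert_of_forall_le {x : α} {r : List α} (h : ∀ z ∈ r, z ≤ x) :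
    rowInsert x r = (r ++ [x], none) := by
  induction r with
  | nil => simp [rowInsert]
  | cons a r ih =>
    simp only [rowInsert, ih fun z hz => h z (List.mem_cons_of_mem a hz)]
    simp [h a]

theorem forall_le_of_rowInsert_eq_none {x : α} {r : List α} (h : (rowInsert x r).2 = none) :
    ∀ z ∈ r, z ≤ x := by
  induction r with
  | nil => simp
  | cons a r ih => simp only [rowInsert] at h; split_ifs at h; simp_all

theorem le_of_mem_of_rowInsert_eq_some {x y z : α} {r : List α} (hr : r.Pairwise (· ≤ ·))
    (h : (rowInsert x r).2 = some y) (hz : z ∈ r) (hxz : x < z) : y ≤ z := by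
  induction r with
  | nil => simp at hz
  | cons a r ih =>
    rw [List.pairwise_cons] at hr
    simp only [rowInsert] at h
    split_ifs at h with hxa
    · obtain rfl := Option.some.inj h
      rcases List.mem_cons.1 hz with rfl | hz
      · exact le_rfl
      · exact hr.1 z hz
    · rcases List.mem_cons.1 hz with rfl | hz
      · exact absurd hxz hxa
      · exact ih hr.2 h hz

theorem le_of_mem_rowInsert_of_lt {x y z : α} {r : List α} (hr : r.Pairwise (· ≤ ·))
    (h : (rowInsert x r).2 = some y) (hz : z ∈ (rowInsert x r).1) (hzy : z < y) : z ≤ x := by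
  rcases mem_of_mem_rowInsert hz with rfl | hz'
  · exact le_rfl
  · exact le_of_not_gt fun hxz => absurd (le_of_mem_of_rowInsert_eq_some hr h hz' hxz) hzy.not_ge

theorem pairwise_rowInsert (x : α) {r : List α} (hr : r.Pairwise (· ≤ ·)) :
    (rowInsert x r).1.Pairwise (· ≤ ·) := by
  induction r with
  | nil => simp [rowInsert]
  | cons a r ih =>
    rw [List.pairwise_cons] at hr
    simp only [rowInsert]
    split_ifs with hxa
    · exact List.pairwise_cons.2 ⟨fun z hz => hxa.le.trans (hr.1 z hz), hr.2⟩
    · refine List.pairwise_cons.2 ⟨fun z hz => ?_, ih hr.2⟩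
      rcases mem_of_mem_rowInsert hz with rfl | hz
      · exact not_lt.1 hxa
      · exact hr.1 z hz

theorem columnsLT_nil (r : List α) : ColumnsLT r [] := by simp [ColumnsLT]

theorem ColumnsLT.append {r s : List α} (h : ColumnsLT r s) (t : List α) :
    ColumnsLT (r ++ t) s := by
  induction r generalizing s with
  | nil => cases s <;> simp_all [ColumnsLT]
  | cons a r ih => cases s <;> simp_all [ColumnsLT]

theorem ColumnsLT.rowInsert {r s : List α} (h : ColumnsLT r s) (x : α) :
    ColumnsLT (rowInsert x r).1 s := by
  induction r generalizing s with
  | nil => cases s <;> simp_all [ColumnsLT]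
  | cons a r ih =>
    cases s with
    | nil => exact columnsLT_nil _
    | cons b s =>
      simp only [ColumnsLT] at h
      simp only [_root_.rowInsert]
      split_ifs with hxa
      · exact ⟨hxa.trans h.1, h.2⟩
      · exact ⟨h.1, ih h.2⟩

theorem ColumnsLT.rowInsert_rowInsert {r s : List α} {x y : α} (h : ColumnsLT r s)
    (hy : (_root_.rowInsert x r).2 = some y) :
    ColumnsLT (_root_.rowInsert x r).1 (_root_.rowInsert y s).1 := by
  induction r generalizing s with
  | nil => simp [_root_.rowInsert] at hy
  | cons a r ih =>
    have hxy := lt_of_rowInsert_eq_some hy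
    simp only [_root_.rowInsert] at hy ⊢
    split_ifs at hy ⊢ with hxa
    · obtain rfl := Option.some.inj hy
      cases s with
      | nil => exact ⟨hxy, columnsLT_nil _⟩
      | cons b s =>
        simp only [_root_.rowInsert, if_pos h.1]
        exact ⟨hxy, h.2⟩
    · have hay := (not_lt.1 hxa).trans_lt hxy
      cases s with
      | nil => exact ⟨hay, columnsLT_nil _⟩
      | cons b s =>
        simp only [_root_.rowInsert]
        split_ifs
        · exact ⟨hay, h.2.rowInsert x⟩
        · exact ⟨h.1, ih h.2 hy⟩

theorem headD_tableauInsert (x : α) (T : List (List α)) :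
    (tableauInsert x T).headD [] = (rowInsert x (T.headD [])).1 := by
  cases T with
  | nil => simp [tableauInsert, rowInsert]
  | cons r rs => rw [tableauInsert]; split <;> simp

theorem IsTableau.tableauInsert {T : List (List α)} (hT : IsTableau T) (x : α) :
    IsTableau (tableauInsert x T) := by
  induction T generalizing x with
  | nil => simp [_root_.tableauInsert, IsTableau, ColumnsLT]
  | cons r rs ih =>
    obtain ⟨-, hr, hc, hrs⟩ := hT
    have hne : (rowInsert x r).1 ≠ [] := List.ne_nil_of_mem (mem_rowInsert_self x r)
    rw [_root_.tableauInsert]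
    split <;> rename_i h
    · exact ⟨hne, pairwise_rowInsert x hr, hc.rowInsert x, hrs⟩
    · refine ⟨hne, pairwise_rowInsert x hr, ?_, ih hrs _⟩
      rw [headD_tableauInsert]
      exact hc.rowInsert_rowInsert h

theorem rsTableau_append_singleton (l : List α) (x : α) :
    rsTableau (l ++ [x]) = tableauInsert x (rsTableau l) := by
  simp [rsTableau]

theorem isTableau_rsTableau (l : List α) : IsTableau (rsTableau l) := by
  induction l using List.reverseRecOn with
  | nil => simp [rsTableau, IsTableau]
  | append_singleton l x ih => rw [rsTableau_append_singleton]; exact ih.tableauInsert x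

theorem flatten_tableauInsert_perm (x : α) (T : List (List α)) :
    (tableauInsert x T).flatten ~ x :: T.flatten := by
  induction T generalizing x with
  | nil => simp [tableauInsert]
  | cons r rs ih =>
    have h := rowInsert_perm x r
    rw [tableauInsert]
    split <;> rename_i h' <;> simp only [h', Option.toList] at h
    · exact h.append_right rs.flatten
    · refine (((ih _).append_left _).trans List.perm_middle).trans ?_
      exact h.append_right rs.flatten

theorem flatten_rsTableau_perm (l : List α) : (rsTableau l).flatten ~ l := by
  induction l using List.reverseRecOn with
  | nil => simp [rsTableau]
  | append_singleton l x ih =>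
    rw [rsTableau_append_singleton]
    exact (flatten_tableauInsert_perm _ _).trans
      ((ih.cons x).trans (List.perm_append_singleton x l).symm)

end Tableaux

/-! ### Decreasing sublists and the number of rows -/

section DecreasingTransfer

open scoped List

variable {α : Type*} [LinearOrder α]

/-- Each decreasing sublist of `u` can be replaced by one of `v` of the same length, all of whose
entries lie within the range of the entries of the former. -/
def DecreasingTransfer (u v : List α) : Prop :=
  ∀ s, s <+ u → s.Pairwise (· > ·) → ∃ t, t <+ v ∧ t.Pairwise (· > ·) ∧ t.length = s.length ∧
    (∀ b, (∀ z ∈ s, z < b) → ∀ z ∈ t, z < b) ∧ (∀ b, (∀ z ∈ s, b < z) → ∀ z ∈ t, b < z)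

theorem DecreasingTransfer.refl (u : List α) : DecreasingTransfer u u :=
  fun s hs hd => ⟨s, hs, hd, rfl, fun _ h => h, fun _ h => h⟩

theorem DecreasingTransfer.trans {u v w : List α} (h : DecreasingTransfer u v)
    (h' : DecreasingTransfer v w) : DecreasingTransfer u w := by
  intro s hs hd
  obtain ⟨t, ht, htd, htl, hup, hlo⟩ := h s hs hd
  obtain ⟨q, hq, hqd, hql, hup', hlo'⟩ := h' t ht htd
  exact ⟨q, hq, hqd, hql.trans htl, fun b hb => hup' b (hup b hb), fun b hb => hlo' b (hlo b hb)⟩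

theorem DecreasingTransfer.append {u u' v v' : List α} (h : DecreasingTransfer u u')
    (h' : DecreasingTransfer v v') : DecreasingTransfer (u ++ v) (u' ++ v') := by
  intro s hs hd
  obtain ⟨s₁, s₂, rfl, hs₁, hs₂⟩ := List.sublist_append_iff.1 hs
  obtain ⟨hd₁, hd₂, hd₁₂⟩ := List.pairwise_append.1 hd
  obtain ⟨t₁, ht₁, htd₁, htl₁, hup₁, hlo₁⟩ := h s₁ hs₁ hd₁
  obtain ⟨t₂, ht₂, htd₂, htl₂, hup₂, hlo₂⟩ := h' s₂ hs₂ hd₂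
  refine ⟨t₁ ++ t₂, ht₁.append ht₂, List.pairwise_append.2 ⟨htd₁, htd₂, fun a ha b hb => ?_⟩,
    by simp [htl₁, htl₂], fun b hb z hz => ?_, fun b hb z hz => ?_⟩
  · exact hlo₁ b (fun w hw => hup₂ w (fun z hz => hd₁₂ w hw z hz) b hb) a ha
  · rcases List.mem_append.1 hz with hz | hz
    · exact hup₁ b (fun w hw => hb w (List.mem_append_left _ hw)) z hz
    · exact hup₂ b (fun w hw => hb w (List.mem_append_right _ hw)) z hz
  · rcases List.mem_append.1 hz with hz | hz
    · exact hlo₁ b (fun w hw => hb w (List.mem_append_left _ hw)) z hz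
    · exact hlo₂ b (fun w hw => hb w (List.mem_append_right _ hw)) z hz

theorem eq_nil_or_singleton_of_decreasing_sublist {r s : List α} (hr : r.Pairwise (· ≤ ·))
    (hs : s <+ r) (hd : s.Pairwise (· > ·)) : s = [] ∨ ∃ z ∈ r, s = [z] := by
  match s, hs, hd with
  | [], _, _ => exact Or.inl rfl
  | [z], hs, _ => exact Or.inr ⟨z, hs.subset (by simp), rfl⟩
  | a :: b :: s, hs, hd =>
    have h1 := (List.pairwise_cons.1 (hr.sublist hs)).1 b (by simp)
    exact absurd ((List.pairwise_cons.1 hd).1 b (by simp)) (not_lt.2 h1)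

theorem decreasingTransfer_rowInsert {x y : α} {r : List α} (hr : r.Pairwise (· ≤ ·))
    (h : (rowInsert x r).2 = some y) :
    DecreasingTransfer (r ++ [x]) (y :: (rowInsert x r).1) ∧
      DecreasingTransfer (y :: (rowInsert x r).1) (r ++ [x]) := by
  have hp : y :: (rowInsert x r).1 ~ x :: r := by simpa [h] using rowInsert_perm x r
  have hp' : y :: (rowInsert x r).1 ~ r ++ [x] := hp.trans (List.perm_append_singleton x r).symm
  have hxy := lt_of_rowInsert_eq_some h
  have hyr : y ∈ r := by
    rcases List.mem_cons.1 (hp.subset List.mem_cons_self) with h | h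
    · exact absurd h hxy.ne'
    · exact h
  have single : ∀ z ∈ r ++ [x], ∃ t, t <+ y :: (rowInsert x r).1 ∧ t.Pairwise (· > ·) ∧
      t.length = [z].length ∧ (∀ b, (∀ w ∈ [z], w < b) → ∀ w ∈ t, w < b) ∧
      (∀ b, (∀ w ∈ [z], b < w) → ∀ w ∈ t, b < w) := fun z hz =>
    ⟨[z], List.singleton_sublist.2 (hp'.symm.subset hz), by simp, rfl, fun _ h => h, fun _ h => h⟩
  constructor
  · intro s hs hd
    obtain ⟨s₁, s₂, rfl, hs₁, hs₂⟩ := List.sublist_append_iff.1 hs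
    obtain ⟨hd₁, -, hd₁₂⟩ := List.pairwise_append.1 hd
    rcases eq_nil_or_singleton_of_decreasing_sublist hr hs₁ hd₁ with rfl | ⟨z, hz, rfl⟩
    · rcases eq_nil_or_singleton_of_decreasing_sublist (by simp) hs₂ (by simp_all) with
        rfl | ⟨w, hw, rfl⟩
      · exact ⟨[], by simp⟩
      · exact single w (List.mem_append_right _ hw)
    · rcases List.sublist_singleton.1 hs₂ with rfl | rfl
      · exact single z (List.mem_append_left _ hz)
      · have hxz : x < z := hd₁₂ z (by simp) x (by simp)
        have hyz := le_of_mem_of_rowInsert_eq_some hr h hz hxz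
        refine ⟨[y, x], (List.singleton_sublist.2 (mem_rowInsert_self x r)).cons_cons y,
          by simpa using hxy, rfl, fun b hb => ?_, fun b hb => ?_⟩
        · simp only [List.mem_append, List.mem_cons] at hb ⊢
          rintro w (rfl | rfl | hw)
          · exact hyz.trans_lt (hb z (by simp))
          · exact hb w (by simp)
          · simp at hw
        · have hbx := hb x (by simp)
          simp [hbx, hbx.trans hxy]
  · intro s hs hd
    have hs' : ∀ z ∈ s, z ∈ r ++ [x] := fun z hz => hp'.subset (hs.subset hz)
    rcases List.sublist_cons_iff.1 hs with hs | ⟨q, rfl, hq⟩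
    · rcases eq_nil_or_singleton_of_decreasing_sublist (pairwise_rowInsert x hr) hs hd with
        rfl | ⟨w, hw, rfl⟩
      · exact ⟨[], by simp⟩
      · exact ⟨[w], List.singleton_sublist.2 (hs' w (by simp)), by simp, rfl, by simp, by simp⟩
    · rw [List.pairwise_cons] at hd
      rcases eq_nil_or_singleton_of_decreasing_sublist (pairwise_rowInsert x hr) hq hd.2 with
        rfl | ⟨w, hw, rfl⟩
      · exact ⟨[y], List.singleton_sublist.2 (hs' y (by simp)), by simp, rfl, by simp, by simp⟩
      · have hwx := le_of_mem_rowInsert_of_lt hr h hw (hd.1 w (by simp))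
        refine ⟨[y, x], (List.singleton_sublist.2 hyr).append (List.Sublist.refl [x]),
          by simpa using hxy, rfl, fun b hb => ?_, fun b hb => ?_⟩
        · have hyb := hb y (by simp)
          simp [hyb, hxy.trans hyb]
        · have hbx := (hb w (by simp)).trans_le hwx
          simp [hbx, hbx.trans hxy]

/-- The reading word of a tableau: its rows, from bottom to top. -/
def readingWord : List (List α) → List α
  | [] => []
  | r :: rs => readingWord rs ++ r

theorem decreasingTransfer_tableauInsert (x : α) {T : List (List α)} (hT : IsTableau T) :
    DecreasingTransfer (readingWord T ++ [x]) (readingWord (tableauInsert x T)) ∧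
      DecreasingTransfer (readingWord (tableauInsert x T)) (readingWord T ++ [x]) := by
  induction T generalizing x with
  | nil => simp [readingWord, tableauInsert, DecreasingTransfer.refl]
  | cons r rs ih =>
    obtain ⟨-, hr, -, hrs⟩ := hT
    rw [tableauInsert]
    split <;> rename_i h
    · rw [rowInsert_of_forall_le (forall_le_of_rowInsert_eq_none h)]
      simp [readingWord, DecreasingTransfer.refl]
    · rename_i y
      obtain ⟨h1, h2⟩ := decreasingTransfer_rowInsert hr h
      obtain ⟨h3, h4⟩ := ih y hrs
      have h5 := (DecreasingTransfer.refl (readingWord rs)).append h1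
      have h6 := (DecreasingTransfer.refl (readingWord rs)).append h2
      have h7 := h3.append (DecreasingTransfer.refl (rowInsert x r).1)
      have h8 := h4.append (DecreasingTransfer.refl (rowInsert x r).1)
      simp only [readingWord, List.append_assoc, List.singleton_append] at h5 h6 h7 h8 ⊢
      exact ⟨h5.trans h7, h8.trans h6⟩

theorem decreasingTransfer_rsTableau (l : List α) :
    DecreasingTransfer l (readingWord (rsTableau l)) ∧
      DecreasingTransfer (readingWord (rsTableau l)) l := by
  induction l using List.reverseRecOn with
  | nil => simp [rsTableau, readingWord, DecreasingTransfer.refl]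
  | append_singleton l x ih =>
    rw [rsTableau_append_singleton]
    have h := decreasingTransfer_tableauInsert x (isTableau_rsTableau l)
    exact ⟨(ih.1.append (.refl [x])).trans h.1, h.2.trans (ih.2.append (.refl [x]))⟩

theorem length_le_of_sublist_readingWord {T : List (List α)} (hT : IsTableau T) {s : List α}
    (hs : s <+ readingWord T) (hd : s.Pairwise (· > ·)) : s.length ≤ T.length := by
  induction T generalizing s with
  | nil => simp_all [readingWord]
  | cons r rs ih =>
    obtain ⟨s₁, s₂, rfl, hs₁, hs₂⟩ := List.sublist_append_iff.1 hs
    obtain ⟨hd₁, hd₂, -⟩ := List.pairwise_append.1 hd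
    have h1 := ih hT.2.2.2 hs₁ hd₁
    rcases eq_nil_or_singleton_of_decreasing_sublist hT.2.1 hs₂ hd₂ with rfl | ⟨z, -, rfl⟩ <;>
      simp <;> omega

theorem exists_decreasing_sublist_readingWord {T : List (List α)} (hT : IsTableau T) :
    ∃ s, s <+ readingWord T ∧ s.Pairwise (· > ·) ∧ s.length = T.length ∧
      ∀ z ∈ s, ∀ a ∈ (T.headD []).head?, a ≤ z := by
  induction T with
  | nil => exact ⟨[], by simp⟩
  | cons r rs ih =>
    obtain ⟨hne, -, hc, hrs⟩ := hT
    obtain ⟨s, hs, hd, hlen, hle⟩ := ih hrs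
    obtain ⟨a, r, rfl⟩ := List.exists_cons_of_ne_nil hne
    have hlt : ∀ z ∈ s, a < z := by
      intro z hz
      match rs, hrs, hc, hle with
      | [], _, _, _ => simp_all
      | [] :: _, hrs, _, _ => exact absurd rfl hrs.1
      | (b :: _) :: _, _, hc, hle => exact hc.1.trans_le (hle z hz b (by simp))
    refine ⟨s ++ [a], hs.append (by simp), List.pairwise_append.2 ⟨hd, by simp, ?_⟩,
      by simp [hlen], ?_⟩
    · simpa using hlt
    · rintro z hz b hb
      obtain rfl : a = b := by simpa using hb
      rcases List.mem_append.1 hz with hz | hz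
      · exact (hlt z hz).le
      · simp_all

theorem length_rsTableau_eq_dsPasses {l : List α} (hl : l.Nodup) :
    (rsTableau l).length = dsPasses l := by
  have hT := isTableau_rsTableau l
  obtain ⟨h1, h2⟩ := decreasingTransfer_rsTableau l
  apply le_antisymm
  · obtain ⟨s, hs, hd, hlen, -⟩ := exists_decreasing_sublist_readingWord hT
    obtain ⟨t, ht, htd, htl, -⟩ := h2 s hs hd
    rw [← hlen, ← htl]
    exact length_le_dsPasses ht htd
  · obtain ⟨s, hs, hd, hlen⟩ := exists_decreasing_sublist_length_eq_dsPasses hl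
    obtain ⟨t, ht, htd, htl, -⟩ := h1 s hs hd
    rw [← hlen, ← htl]
    exact length_le_of_sublist_readingWord hT ht htd

end DecreasingTransfer

/-! ### Reverse bumping -/

section ReverseBumping

variable {α : Type*} [LinearOrder α]

theorem rowInsert_injective {x x' y : α} {r r' : List α} (hr : r.Pairwise (· ≤ ·))
    (hr' : r'.Pairwise (· ≤ ·)) (h : (rowInsert x r).2 = some y)
    (h' : (rowInsert x' r').2 = some y) (he : (rowInsert x r).1 = (rowInsert x' r').1) :
    x = x' ∧ r = r' := by
  have hx : x = x' := le_antisymm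
    (le_of_mem_rowInsert_of_lt hr' h' (he ▸ mem_rowInsert_self x r) (lt_of_rowInsert_eq_some h))
    (le_of_mem_rowInsert_of_lt hr h (he ▸ mem_rowInsert_self x' r') (lt_of_rowInsert_eq_some h'))
  subst hx
  refine ⟨rfl, List.Perm.eq_of_pairwise' hr hr' ?_⟩
  have h1 := rowInsert_perm x r
  have h2 := rowInsert_perm x r'
  rw [h, he] at h1
  rw [h'] at h2
  exact (h1.symm.trans h2).cons_inv

theorem length_rowInsert_of_eq_some {x y : α} {r : List α} (h : (rowInsert x r).2 = some y) :
    (rowInsert x r).1.length = r.length := by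
  simpa [h] using length_rowInsert x r

theorem tableauInsert_injective {x x' : α} {T T' : List (List α)} (hT : IsTableau T)
    (hT' : IsTableau T') (hs : T.map List.length = T'.map List.length)
    (he : tableauInsert x T = tableauInsert x' T') : x = x' ∧ T = T' := by
  induction T generalizing x x' T' with
  | nil =>
    obtain rfl : T' = [] := by simpa using hs.symm
    simpa [tableauInsert] using he
  | cons r rs ih =>
    cases T' with
    | nil => simp at hs
    | cons r' rs' =>
      simp only [List.map_cons, List.cons.injEq] at hs
      have hl := length_rowInsert x r
      have hl' := length_rowInsert x' r'
      rw [tableauInsert, tableauInsert] at he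
      split at he <;> rename_i h <;> split at he <;> rename_i h' <;>
        obtain ⟨he₁, he₂⟩ := List.cons.inj he
      · rw [rowInsert_of_forall_le (forall_le_of_rowInsert_eq_none h),
          rowInsert_of_forall_le (forall_le_of_rowInsert_eq_none h')] at he₁
        obtain ⟨h1, h2⟩ := List.append_inj' he₁ rfl
        simp_all
      · rw [he₁] at hl; simp [h, h'] at hl hl'; omega
      · rw [he₁] at hl; simp [h, h'] at hl hl'; omega
      · obtain ⟨rfl, rfl⟩ := ih hT.2.2.2 hT'.2.2.2 hs.2 he₂
        obtain ⟨rfl, rfl⟩ := rowInsert_injective hT.2.1 hT'.2.1 h h' he₁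
        exact ⟨rfl, rfl⟩

theorem exists_rowInsert_eq {y : α} {r : List α} (hr : r.Pairwise (· ≤ ·))
    (hy : ∃ z ∈ r, z < y) : ∃ x s, s.Pairwise (· ≤ ·) ∧ rowInsert x s = (r, some y) := by
  induction r with
  | nil => simp at hy
  | cons a r ih =>
    rw [List.pairwise_cons] at hr
    by_cases h : ∃ z ∈ r, z < y
    · obtain ⟨x, s, hs, he⟩ := ih hr.2 h
      have hp := rowInsert_perm x s
      rw [he] at hp
      have hx : x ∈ r := by simpa [he] using mem_rowInsert_self x s
      refine ⟨x, a :: s, List.pairwise_cons.2 ⟨fun z hz => ?_, hs⟩, ?_⟩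
      · have : z ∈ y :: r := hp.symm.subset (List.mem_cons_of_mem x hz)
        rcases List.mem_cons.1 this with rfl | hz
        · obtain ⟨w, hw, hwz⟩ := h
          exact (hr.1 w hw).trans hwz.le
        · exact hr.1 z hz
      · simp [rowInsert, he, hr.1 x hx]
    · have hay : a < y := by
        obtain ⟨z, hz, hzy⟩ := hy
        rcases List.mem_cons.1 hz with rfl | hz
        · exact hzy
        · exact absurd ⟨z, hz, hzy⟩ h
      refine ⟨a, y :: r, List.pairwise_cons.2 ⟨fun z hz => ?_, hr.2⟩, by simp [rowInsert, hay]⟩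
      exact le_of_not_gt fun hzy => h ⟨z, hz, hzy⟩

theorem ColumnsLT.exists_lt_of_mem {r s : List α} (h : ColumnsLT r s) {a : α} (ha : a ∈ s) :
    ∃ z ∈ r, z < a := by
  induction r generalizing s with
  | nil => cases s <;> simp_all [ColumnsLT]
  | cons c r ih =>
    cases s with
    | nil => simp at ha
    | cons b s =>
      rcases List.mem_cons.1 ha with rfl | ha
      · exact ⟨c, by simp, h.1⟩
      · obtain ⟨z, hz, hza⟩ := ih h.2 ha
        exact ⟨z, List.mem_cons_of_mem c hz, hza⟩

theorem ColumnsLT.of_rowInsert {r s : List α} {x y : α} (h : ColumnsLT (_root_.rowInsert x r).1 s)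
    (hy : (_root_.rowInsert x r).2 = some y) (hs : ∀ z ∈ s, y < z) : ColumnsLT r s := by
  induction r generalizing s with
  | nil => simp [_root_.rowInsert] at hy
  | cons a r ih =>
    cases s with
    | nil => exact columnsLT_nil _
    | cons b s =>
      simp only [_root_.rowInsert] at h hy
      split_ifs at h hy
      · obtain rfl := Option.some.inj hy
        exact ⟨hs b (by simp), h.2⟩
      · exact ⟨h.1, ih h.2 hy fun z hz => hs z (List.mem_cons_of_mem b hz)⟩

theorem ColumnsLT.of_rowInsert_rowInsert {r s : List α} {x y : α} (hr : r.Pairwise (· ≤ ·))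
    (hs : s.Pairwise (· ≤ ·))
    (h : ColumnsLT (_root_.rowInsert x r).1 (_root_.rowInsert y s).1)
    (hy : (_root_.rowInsert x r).2 = some y) : ColumnsLT r s := by
  induction r generalizing s with
  | nil => simp [_root_.rowInsert] at hy
  | cons a r ih =>
    cases s with
    | nil => exact columnsLT_nil _
    | cons b s =>
      rw [List.pairwise_cons] at hr hs
      simp only [_root_.rowInsert] at h hy
      split_ifs at h hy with hxa hyb hyb
      · obtain rfl := Option.some.inj hy
        exact ⟨hyb, h.2⟩
      · obtain rfl := Option.some.inj hy
        obtain ⟨z, hz, hza⟩ := h.2.exists_lt_of_mem (mem_rowInsert_self a s)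
        exact absurd (hr.1 z hz) (not_le.2 hza)
      · exact ⟨h.1.trans hyb, h.2.of_rowInsert hy fun z hz => hyb.trans_le (hs.1 z hz)⟩
      · exact ⟨h.1, ih hr.2 hs.2 h.2 hy⟩

theorem ColumnsLT.of_append_left {r s t : List α} (h : ColumnsLT (r ++ t) s)
    (hl : s.length ≤ r.length) : ColumnsLT r s := by
  induction r generalizing s with
  | nil => simp_all [ColumnsLT]
  | cons a r ih =>
    cases s with
    | nil => exact columnsLT_nil _
    | cons b s => exact ⟨h.1, ih h.2 (by simpa using hl)⟩

theorem ColumnsLT.of_append_right {r s t : List α} (h : ColumnsLT r (s ++ t)) :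
    ColumnsLT r s := by
  induction r generalizing s with
  | nil => cases s <;> simp_all [ColumnsLT]
  | cons a r ih =>
    cases s with
    | nil => exact columnsLT_nil _
    | cons b s => exact ⟨h.1, ih h.2⟩

theorem ColumnsLT.length_le {r s : List α} (h : ColumnsLT r s) : s.length ≤ r.length := by
  induction r generalizing s with
  | nil => cases s <;> simp_all [ColumnsLT]
  | cons a r ih =>
    cases s with
    | nil => simp
    | cons b s => simpa using ih h.2

theorem IsTableau.pos_of_mem_map_length {T : List (List α)} (hT : IsTableau T) :
    ∀ a ∈ T.map List.length, 0 < a := by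
  induction T with
  | nil => simp
  | cons r rs ih =>
    rw [List.map_cons, List.forall_mem_cons]
    exact ⟨List.length_pos_of_ne_nil hT.1, ih hT.2.2.2⟩

theorem IsTableau.pairwise_map_length {T : List (List α)} (hT : IsTableau T) :
    (T.map List.length).Pairwise (· ≥ ·) := by
  rw [← List.isChain_iff_pairwise]
  induction T with
  | nil => simp
  | cons r rs ih =>
    cases rs with
    | nil => simp
    | cons s rs =>
      simp only [List.map_cons, List.isChain_cons_cons]
      exact ⟨hT.2.2.1.length_le, ih hT.2.2.2⟩

/-- Adds a cell at the end of the `k`-th row of a shape, or a new row at its bottom. -/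
def addBox : ℕ → List ℕ → List ℕ
  | _, [] => [1]
  | 0, a :: l => (a + 1) :: l
  | k + 1, a :: l => a :: addBox k l

/-- Adds an entry at the end of the `k`-th row of a tableau, or as a new row at its bottom. -/
def addCell {β : Type*} (v : β) : ℕ → List (List β) → List (List β)
  | _, [] => [[v]]
  | 0, r :: rs => (r ++ [v]) :: rs
  | k + 1, r :: rs => r :: addCell v k rs

/-- The index of the row in which the insertion of `x` into a tableau creates a cell. -/
def insertionRow (x : α) : List (List α) → ℕ
  | [] => 0
  | r :: rs =>
    match (rowInsert x r).2 with
    | none => 0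
    | some y => insertionRow y rs + 1

theorem map_length_addCell {β : Type*} (v : β) (k : ℕ) (T : List (List β)) :
    (addCell v k T).map List.length = addBox k (T.map List.length) := by
  induction T generalizing k with
  | nil => simp [addCell, addBox]
  | cons r rs ih => cases k <;> simp [addCell, addBox, ih]

theorem map_length_tableauInsert (x : α) (T : List (List α)) :
    (tableauInsert x T).map List.length = addBox (insertionRow x T) (T.map List.length) := by
  induction T generalizing x with
  | nil => simp [tableauInsert, addBox]
  | cons r rs ih =>
    have hl := length_rowInsert x r
    rw [tableauInsert, insertionRow]
    split <;> rename_i h <;> simp [h] at hl ⊢ <;> simp [addBox, hl, ih]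

theorem insertionRow_le_length (x : α) (T : List (List α)) : insertionRow x T ≤ T.length := by
  induction T generalizing x with
  | nil => simp [insertionRow]
  | cons r rs ih =>
    rw [insertionRow]
    split
    · simp
    · simpa using ih _

theorem addBox_injective {k k' : ℕ} {l : List ℕ} (hk : k ≤ l.length) (hk' : k' ≤ l.length)
    (h : addBox k l = addBox k' l) : k = k' := by
  induction l generalizing k k' with
  | nil => simp_all
  | cons a l ih =>
    cases k <;> cases k' <;> simp_all [addBox]
    exact ih hk hk' h

theorem exists_tableauInsert_eq {P : List (List α)} (hP : IsTableau P) {k : ℕ} {μ : List ℕ}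
    (hμ : μ.Pairwise (· ≥ ·)) (hpos : ∀ a ∈ μ, 0 < a) (hk : k ≤ μ.length)
    (hs : P.map List.length = addBox k μ) :
    ∃ x T, IsTableau T ∧ T.map List.length = μ ∧ tableauInsert x T = P := by
  induction P generalizing k μ with
  | nil => cases μ <;> cases k <;> simp [addBox] at hs
  | cons r rs ih =>
    obtain ⟨-, hr, hc, hrs⟩ := hP
    cases μ with
    | nil =>
      simp only [addBox, List.map_cons, List.cons.injEq, List.map_eq_nil_iff,
        List.length_eq_one_iff] at hs
      obtain ⟨⟨x, rfl⟩, rfl⟩ := hs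
      exact ⟨x, [], trivial, rfl, rfl⟩
    | cons m μ =>
      rw [List.pairwise_cons] at hμ
      cases k with
      | zero =>
        simp only [addBox, List.map_cons, List.cons.injEq] at hs
        obtain ⟨q, x, rfl⟩ : ∃ q x, r = q ++ [x] :=
          ⟨_, _, (List.dropLast_append_getLast (List.ne_nil_of_length_pos (by omega))).symm⟩
        have hq : q.length = m := by simpa using hs.1
        obtain ⟨hq₁, -, hq₂⟩ := List.pairwise_append.1 hr
        refine ⟨x, q :: rs, ⟨?_, hq₁, hc.of_append_left ?_, hrs⟩, by simp [hq, hs.2], ?_⟩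
        · exact List.ne_nil_of_length_pos (hq ▸ hpos m (by simp))
        · cases rs with
          | nil => simp
          | cons s rs =>
            have hsm : s.length ∈ μ := by simp [← hs.2]
            simpa [hq] using hμ.1 _ hsm
        · rw [tableauInsert, rowInsert_of_forall_le fun z hz => hq₂ z hz x (by simp)]
      | succ k =>
        simp only [addBox, List.map_cons, List.cons.injEq] at hs
        obtain ⟨y, T, hT, hTs, hTi⟩ := ih hrs hμ.2 (fun a ha => hpos a (by simp [ha]))
          (by simpa using hk) hs.2
        have hhead : (rowInsert y (T.headD [])).1 = rs.headD [] := by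
          rw [← hTi, headD_tableauInsert]
        have hsort : (T.headD []).Pairwise (· ≤ ·) := by
          cases T with
          | nil => simp
          | cons t T => exact hT.2.1
        obtain ⟨x, q, hq, hqi⟩ := exists_rowInsert_eq (y := y) hr
          (hc.exists_lt_of_mem (hhead ▸ mem_rowInsert_self y _))
        have hq1 : (rowInsert x q).1 = r := by rw [hqi]
        have hq2 : (rowInsert x q).2 = some y := by rw [hqi]
        refine ⟨x, q :: T, ⟨?_, hq, ?_, hT⟩, ?_, ?_⟩
        · rintro rfl
          simp [rowInsert] at hqi
        · exact ColumnsLT.of_rowInsert_rowInsert hq hsort (by rwa [hhead, hq1]) hq2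
        · have := length_rowInsert_of_eq_some hq2
          rw [hq1, hs.1] at this
          simp [← this, hTs]
        · rw [tableauInsert, hqi]
          simp [hTi]

end ReverseBumping

/-! ### Adding and removing the cell of the largest entry -/

section LargestEntry

open scoped List

variable {α : Type*} [LinearOrder α]

theorem flatten_addCell_perm {β : Type*} (v : β) (k : ℕ) (T : List (List β)) :
    (addCell v k T).flatten ~ v :: T.flatten := by
  induction T generalizing k with
  | nil => simp [addCell]
  | cons r rs ih =>
    cases k with
    | zero => simp [addCell]
    | succ k =>
      exact ((ih k).append_left r).trans List.perm_middle

theorem addCell_injective {v : α} {k k' : ℕ} {T T' : List (List α)} (hT : IsTableau T)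
    (hT' : IsTableau T') (hv : v ∉ T.flatten) (hv' : v ∉ T'.flatten) (hk : k ≤ T.length)
    (hk' : k' ≤ T'.length) (h : addCell v k T = addCell v k' T') : k = k' ∧ T = T' := by
  induction T generalizing k k' T' with
  | nil =>
    obtain rfl : k = 0 := by simpa using hk
    cases T' with
    | nil => simp_all
    | cons r' rs' =>
      have := hT'.1
      cases k' with
      | zero => simp_all [addCell]
      | succ k' => simp only [addCell, List.cons.injEq] at h; simp [← h.1] at hv'
  | cons r rs ih =>
    have hr := hT.1
    cases T' with
    | nil =>
      cases k with
      | zero => simp_all [addCell]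
      | succ k => simp only [addCell, List.cons.injEq] at h; simp [h.1] at hv
    | cons r' rs' =>
      simp only [List.flatten_cons, List.mem_append, not_or] at hv hv'
      cases k <;> cases k' <;> simp only [addCell, List.cons.injEq] at h
      · simp_all
      · simp [← h.1] at hv'
      · simp [h.1] at hv
      · rename_i k k'
        obtain ⟨rfl, rfl⟩ := ih hT.2.2.2 hT'.2.2.2 hv.2 hv'.2 (by simpa using hk)
          (by simpa using hk') h.2
        simp [h.1]

theorem ColumnsLT.append_singleton {r s : List α} {v : α} (h : ColumnsLT r s)
    (hl : s.length < r.length) (hv : ∀ z ∈ r, z < v) : ColumnsLT r (s ++ [v]) := by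
  induction r generalizing s with
  | nil => simp at hl
  | cons a r ih =>
    cases s with
    | nil => exact ⟨hv a (by simp), columnsLT_nil _⟩
    | cons b s =>
      exact ⟨h.1, ih h.2 (by simpa using hl) fun z hz => hv z (List.mem_cons_of_mem a hz)⟩

theorem ColumnsLT.of_append_singleton {r s : List α} {v : α} (h : ColumnsLT (r ++ [v]) s)
    (hv : ∀ z ∈ s, z ≤ v) : ColumnsLT r s := by
  induction r generalizing s with
  | nil =>
    cases s with
    | nil => exact columnsLT_nil _
    | cons b s => exact absurd (hv b (by simp)) (not_le.2 h.1)
  | cons a r ih =>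
    cases s with
    | nil => exact columnsLT_nil _
    | cons b s => exact ⟨h.1, ih h.2 fun z hz => hv z (List.mem_cons_of_mem b hz)⟩

theorem headD_addCell {β : Type*} (v : β) (k : ℕ) (T : List (List β)) :
    (addCell v k T).headD [] = T.headD [] ∨ (addCell v k T).headD [] = T.headD [] ++ [v] := by
  cases T <;> cases k <;> simp [addCell]

theorem IsTableau.addCell {T : List (List α)} (hT : IsTableau T) {v : α} {k : ℕ}
    (hv : ∀ z ∈ T.flatten, z < v)
    (hs : ((addCell v k T).map List.length).Pairwise (· ≥ ·)) : IsTableau (addCell v k T) := by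
  induction T generalizing k with
  | nil => simp [_root_.addCell, IsTableau, ColumnsLT]
  | cons r rs ih =>
    simp only [List.flatten_cons, List.mem_append] at hv
    obtain ⟨hne, hr, hc, hrs⟩ := hT
    cases k with
    | zero =>
      exact ⟨by simp, List.pairwise_append.2 ⟨hr, by simp, by
        simpa using fun z hz => (hv z (Or.inl hz)).le⟩, hc.append _, hrs⟩
    | succ k =>
      simp only [_root_.addCell, List.map_cons, List.pairwise_cons] at hs
      refine ⟨hne, hr, ?_, ih hrs (fun z hz => hv z (Or.inr hz)) hs.2⟩
      rcases headD_addCell v k rs with h | h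
      · rw [h]; exact hc
      · rw [h]
        refine hc.append_singleton ?_ fun z hz => hv z (Or.inl hz)
        have hmem : ((_root_.addCell v k rs).headD []).length ∈
            (_root_.addCell v k rs).map List.length := by
          cases rs <;> cases k <;> simp [_root_.addCell]
        have := hs.1 _ hmem
        rw [h] at this
        simpa using this

theorem IsTableau.exists_eq_addCell {T : List (List α)} (hT : IsTableau T) {v : α}
    (hmem : v ∈ T.flatten) (hle : ∀ z ∈ T.flatten, z ≤ v) :
    ∃ k Q, IsTableau Q ∧ k ≤ Q.length ∧ T = _root_.addCell v k Q := by
  induction T with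
  | nil => simp at hmem
  | cons r rs ih =>
    obtain ⟨-, hr, hc, hrs⟩ := hT
    simp only [List.flatten_cons, List.mem_append] at hmem hle
    by_cases hv : v ∈ rs.flatten
    · obtain ⟨k, Q, hQ, hk, rfl⟩ := ih hrs hv fun z hz => hle z (Or.inr hz)
      have hc' : ColumnsLT r (Q.headD []) := by
        rcases headD_addCell v k Q with h | h
        · rwa [h] at hc
        · rw [h] at hc
          exact hc.of_append_right
      have hne : r ≠ [] := by
        rintro rfl
        have := hc.length_le
        cases Q <;> cases k <;> simp_all [_root_.addCell]
        · exact hQ.1 rfl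
      exact ⟨k + 1, r :: Q, ⟨hne, hr, hc', hQ⟩, by simpa using hk, rfl⟩
    · have hvr : v ∈ r := hmem.resolve_right hv
      obtain ⟨q, w, rfl⟩ : ∃ q w, r = q ++ [w] :=
        ⟨_, _, (List.dropLast_append_getLast (List.ne_nil_of_mem hvr)).symm⟩
      obtain ⟨hq, -, hqw⟩ := List.pairwise_append.1 hr
      obtain rfl : v = w := by
        refine le_antisymm ?_ (hle w (by simp))
        rcases List.mem_append.1 hvr with h | h
        · exact hqw v h w (by simp)
        · exact (List.mem_singleton.1 h).le
      have hc' : ColumnsLT q (rs.headD []) := by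
        refine hc.of_append_singleton fun z hz => hle z (Or.inr ?_)
        cases rs with
        | nil => simp at hz
        | cons s rs => exact List.mem_append_left _ hz
      cases q with
      | nil =>
        have : rs = [] := by
          cases rs with
          | nil => rfl
          | cons s rs =>
            have := hc'.length_le
            exact absurd (by simpa using this) hrs.1
        exact ⟨0, [], trivial, le_rfl, by simp [this, _root_.addCell]⟩
      | cons a q => exact ⟨0, (a :: q) :: rs, ⟨by simp, hq, hc', hrs⟩, by simp, rfl⟩

end LargestEntry

/-! ### The Robinson-Schensted correspondence -/

section Correspondence

open scoped List

variable {α : Type*} [LinearOrder α]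

/-- The recording tableau of the reversal of a list. -/
def rsRecordingReverse : List α → List (List ℕ)
  | [] => []
  | x :: l => addCell (l.length + 1) (insertionRow x (rsTableau l.reverse)) (rsRecordingReverse l)

/-- The Robinson-Schensted recording tableau: the `i`-th inserted entry contributes
the entry `i`, placed in the cell that its insertion creates. -/
def rsRecording (l : List α) : List (List ℕ) :=
  rsRecordingReverse l.reverse

theorem rsRecording_append_singleton (l : List α) (x : α) :
    rsRecording (l ++ [x]) =
      addCell (l.length + 1) (insertionRow x (rsTableau l)) (rsRecording l) := by
  simp [rsRecording, rsRecordingReverse]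

theorem map_length_rsRecording (l : List α) :
    (rsRecording l).map List.length = (rsTableau l).map List.length := by
  induction l using List.reverseRecOn with
  | nil => simp [rsRecording, rsRecordingReverse, rsTableau]
  | append_singleton l x ih =>
    rw [rsRecording_append_singleton, rsTableau_append_singleton, map_length_addCell,
      map_length_tableauInsert, ih]

theorem flatten_rsRecording_perm (l : List α) :
    (rsRecording l).flatten ~ List.range' 1 l.length := by
  induction l using List.reverseRecOn with
  | nil => simp [rsRecording, rsRecordingReverse]
  | append_singleton l x ih =>
    rw [rsRecording_append_singleton, List.length_append, List.length_singleton,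
      List.range'_1_concat, Nat.add_comm 1]
    exact (flatten_addCell_perm _ _ _).trans
      ((ih.cons _).trans (List.perm_append_singleton _ _).symm)

theorem lt_of_mem_flatten_rsRecording {l : List α} {z : ℕ} (hz : z ∈ (rsRecording l).flatten) :
    z < l.length + 1 := by
  have := (flatten_rsRecording_perm l).subset hz
  rw [List.mem_range'_1] at this
  omega

theorem isTableau_rsRecording (l : List α) : IsTableau (rsRecording l) := by
  induction l using List.reverseRecOn with
  | nil => simp [rsRecording, rsRecordingReverse, IsTableau]
  | append_singleton l x ih =>
    have hs := (isTableau_rsTableau (l ++ [x])).pairwise_map_length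
    rw [← map_length_rsRecording] at hs
    rw [rsRecording_append_singleton] at hs ⊢
    exact ih.addCell (fun z hz => lt_of_mem_flatten_rsRecording hz) hs

theorem rsTableau_rsRecording_injective {l l' : List α} (h : rsTableau l = rsTableau l')
    (h' : rsRecording l = rsRecording l') : l = l' := by
  have hlen : l.length = l'.length := by
    rw [← (flatten_rsTableau_perm l).length_eq, h, (flatten_rsTableau_perm l').length_eq]
  induction l using List.reverseRecOn generalizing l' with
  | nil => exact (List.length_eq_zero_iff.1 hlen.symm).symm
  | append_singleton l x ih =>
    rcases List.eq_nil_or_concat' l' with rfl | ⟨l', x', rfl⟩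
    · simp at hlen
    · simp only [List.length_append, List.length_singleton, Nat.add_right_cancel_iff] at hlen
      rw [rsTableau_append_singleton, rsTableau_append_singleton] at h
      rw [rsRecording_append_singleton, rsRecording_append_singleton, hlen] at h'
      have hle : ∀ (l : List α) (x : α),
          insertionRow x (rsTableau l) ≤ (rsRecording l).length := fun l x => by
        have := congrArg List.length (map_length_rsRecording l)
        simp only [List.length_map] at this
        exact this ▸ insertionRow_le_length x _
      obtain ⟨-, hQ⟩ := addCell_injective (isTableau_rsRecording l) (isTableau_rsRecording l')
        (fun hz => by have := lt_of_mem_flatten_rsRecording hz; omega)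
        (fun hz => by have := lt_of_mem_flatten_rsRecording hz; omega) (hle l x) (hle l' x') h'
      obtain ⟨rfl, hT⟩ := tableauInsert_injective (isTableau_rsTableau l) (isTableau_rsTableau l')
        (by rw [← map_length_rsRecording, hQ, map_length_rsRecording]) h
      rw [ih hT hQ hlen]

theorem IsTableau.eq_nil_of_flatten_eq_nil {T : List (List α)} (hT : IsTableau T)
    (h : T.flatten = []) : T = [] := by
  cases T with
  | nil => rfl
  | cons r rs => exact absurd (List.append_eq_nil_iff.1 h).1 hT.1

theorem exists_rsTableau_rsRecording_eq {P : List (List α)} {Q : List (List ℕ)} {n : ℕ}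
    (hP : IsTableau P) (hQ : IsTableau Q) (hs : P.map List.length = Q.map List.length)
    (hn : Q.flatten ~ List.range' 1 n) : ∃ l, rsTableau l = P ∧ rsRecording l = Q := by
  induction n generalizing P Q with
  | zero =>
    obtain rfl := hQ.eq_nil_of_flatten_eq_nil (by simpa using hn)
    obtain rfl : P = [] := by simpa using hs
    exact ⟨[], rfl, rfl⟩
  | succ n ih =>
    rw [List.range'_1_concat, Nat.add_comm 1] at hn
    replace hn := hn.trans (List.perm_append_singleton _ _)
    obtain ⟨k, Q, hQ', hk, rfl⟩ := hQ.exists_eq_addCell (v := n + 1)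
      (hn.symm.subset List.mem_cons_self) fun z hz => by
        have := hn.subset hz
        simp only [List.mem_cons, List.mem_range'_1] at this
        omega
    have hn' : Q.flatten ~ List.range' 1 n :=
      ((flatten_addCell_perm _ _ _).symm.trans hn).cons_inv
    rw [map_length_addCell] at hs
    obtain ⟨x, T, hT, hTs, rfl⟩ := exists_tableauInsert_eq hP hQ'.pairwise_map_length
      hQ'.pos_of_mem_map_length (by simpa using hk) hs
    obtain ⟨l, rfl, rfl⟩ := ih hT hQ' hTs hn'
    refine ⟨l ++ [x], rsTableau_append_singleton l x, ?_⟩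
    have hlen : l.length = n := by
      simpa using ((flatten_rsRecording_perm l).symm.trans hn').length_eq
    rw [rsRecording_append_singleton, hlen]
    congr 1
    rw [map_length_tableauInsert, hTs] at hs
    refine addBox_injective ?_ (by simpa using hk) hs
    rw [← hTs]
    simpa using insertionRow_le_length x _

end Correspondence

/-! ### Standard Young tableaux as lists of rows -/

section StandardTableaux

open scoped List

theorem columnsLT_iff_getElem {α : Type*} [LinearOrder α] {r s : List α} :
    ColumnsLT r s ↔ ∃ hl : s.length ≤ r.length, ∀ (j : ℕ) (hj : j < s.length), r[j] < s[j] := by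
  induction r generalizing s with
  | nil => cases s <;> simp [ColumnsLT]
  | cons a r ih =>
    cases s with
    | nil => simp [ColumnsLT]
    | cons b s =>
      simp only [ColumnsLT, ih, List.length_cons, Nat.add_le_add_iff_right]
      constructor
      · rintro ⟨hab, hl, h⟩
        refine ⟨hl, fun j hj => ?_⟩
        cases j with
        | zero => exact hab
        | succ j => exact h j (by omega)
      · rintro ⟨hl, h⟩
        exact ⟨h 0 (by omega), hl, fun j hj => h (j + 1) (by omega)⟩

theorem ColumnsLT.trans {α : Type*} [LinearOrder α] {r s t : List α} (h : ColumnsLT r s)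
    (h' : ColumnsLT s t) : ColumnsLT r t := by
  rw [columnsLT_iff_getElem] at *
  obtain ⟨hl, h⟩ := h
  obtain ⟨hl', h'⟩ := h'
  exact ⟨hl'.trans hl, fun j hj => (h j (by omega)).trans (h' j hj)⟩

theorem isTableau_iff {α : Type*} [LinearOrder α] {T : List (List α)} :
    IsTableau T ↔ (∀ r ∈ T, r ≠ [] ∧ r.Pairwise (· ≤ ·)) ∧ T.Pairwise ColumnsLT := by
  induction T with
  | nil => simp [IsTableau]
  | cons r rs ih =>
    rw [IsTableau, ih, List.forall_mem_cons, List.pairwise_cons]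
    constructor
    · rintro ⟨h1, h2, h3, h4, h5⟩
      refine ⟨⟨⟨h1, h2⟩, h4⟩, fun s hs => ?_, h5⟩
      cases rs with
      | nil => simp at hs
      | cons t rs =>
        rcases List.mem_cons.1 hs with rfl | hs
        · exact h3
        · exact ColumnsLT.trans h3 ((List.pairwise_cons.1 h5).1 s hs)
    · rintro ⟨⟨⟨h1, h2⟩, h4⟩, h3, h5⟩
      refine ⟨h1, h2, ?_, h4, h5⟩
      cases rs with
      | nil => exact columnsLT_nil _
      | cons t rs => exact h3 t (by simp)

/-- The standard Young tableaux of a given shape, as lists of rows. -/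
def ListStandardTableau (D : YoungDiagram) : Type :=
  {Q : List (List ℕ) // IsTableau Q ∧ Q.map List.length = D.rowLens ∧
    Q.flatten ~ List.range' 1 D.card}

theorem YoungDiagram.card_eq_sum_rowLens (D : YoungDiagram) : D.card = D.rowLens.sum := by
  have h := Finset.card_eq_sum_card_fiberwise (s := D.cells) (t := Finset.range (D.colLen 0))
    (f := Prod.fst) fun c hc => by
      have := D.up_left_mem le_rfl (Nat.zero_le c.2) ((D.mem_cells c).1 hc)
      simpa using YoungDiagram.mem_iff_lt_colLen.1 this
  rw [YoungDiagram.card, h]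
  exact (Finset.sum_congr rfl fun i _ => D.rowLen_eq_card.symm).trans rfl

theorem List.perm_range'_of_mem_iff {l : List ℕ} {n : ℕ} (hl : l.length = n)
    (h : ∀ v, 1 ≤ v → v ≤ n → v ∈ l) : l ~ List.range' 1 n := by
  have hs : List.range' 1 n <+~ l := by
    refine (List.nodup_range' (s := 1) (n := n)).subperm fun v hv => ?_
    rw [List.mem_range'_1] at hv
    exact h v hv.1 (by omega)
  exact (hs.perm_of_length_le (by simp [hl])).symm

/-- The list of rows of a filling of a Young diagram. -/
def fillingRows (D : YoungDiagram) (f : ℕ → ℕ → ℕ) : List (List ℕ) :=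
  (List.range (D.colLen 0)).map fun i => (List.range (D.rowLen i)).map (f i)

theorem map_length_fillingRows (D : YoungDiagram) (f : ℕ → ℕ → ℕ) :
    (fillingRows D f).map List.length = D.rowLens := by
  simp [fillingRows, YoungDiagram.rowLens, Function.comp_def]

theorem YoungDiagram.rowLen_eq_zero {D : YoungDiagram} {i : ℕ} (h : D.colLen 0 ≤ i) :
    D.rowLen i = 0 := by
  by_contra h0
  exact absurd (YoungDiagram.mem_iff_lt_colLen.1
    (YoungDiagram.mem_iff_lt_rowLen.2 (Nat.pos_of_ne_zero h0))) (not_lt.2 h)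

theorem getD_fillingRows {D : YoungDiagram} {f : ℕ → ℕ → ℕ} (hf : ∀ i j, (i, j) ∉ D → f i j = 0)
    (i j : ℕ) : ((fillingRows D f).getD i []).getD j 0 = f i j := by
  by_cases hi : i < D.colLen 0
  · by_cases hj : j < D.rowLen i
    · simp [fillingRows, hi, hj]
    · rw [hf i j (by rwa [YoungDiagram.mem_iff_lt_rowLen])]
      simp [fillingRows, hi, hj]
  · rw [hf i j (by
      rw [YoungDiagram.mem_iff_lt_rowLen, YoungDiagram.rowLen_eq_zero (not_lt.1 hi)]; omega)]
    simp [fillingRows, hi]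

theorem mem_flatten_fillingRows {D : YoungDiagram} {f : ℕ → ℕ → ℕ} {v : ℕ} :
    v ∈ (fillingRows D f).flatten ↔ ∃ c ∈ D.cells, f c.1 c.2 = v := by
  simp only [fillingRows, List.mem_flatten, List.mem_map, List.mem_range, YoungDiagram.mem_cells,
    Prod.exists, YoungDiagram.mem_iff_lt_rowLen]
  constructor
  · rintro ⟨_, ⟨i, -, rfl⟩, hv⟩
    obtain ⟨j, hj, rfl⟩ := List.mem_map.1 hv
    exact ⟨i, j, List.mem_range.1 hj, rfl⟩
  · rintro ⟨i, j, hj, rfl⟩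
    refine ⟨_, ⟨i, ?_, rfl⟩, List.mem_map.2 ⟨j, List.mem_range.2 hj, rfl⟩⟩
    by_contra hi
    rw [YoungDiagram.rowLen_eq_zero (not_lt.1 hi)] at hj
    omega

theorem flatten_fillingRows_perm_iff {D : YoungDiagram} {f : ℕ → ℕ → ℕ} :
    (fillingRows D f).flatten ~ List.range' 1 D.card ↔
      Set.BijOn (fun c : ℕ × ℕ => f c.1 c.2) (D.cells : Set (ℕ × ℕ)) (Set.Icc 1 D.card) := by
  constructor
  · intro h
    have hmem : ∀ v, (∃ c ∈ D.cells, f c.1 c.2 = v) ↔ 1 ≤ v ∧ v ≤ D.card := fun v => by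
      rw [← mem_flatten_fillingRows, h.mem_iff, List.mem_range'_1]
      omega
    refine ⟨fun c hc => (hmem _).1 ⟨c, hc, rfl⟩, ?_, fun v hv => (hmem v).2 hv⟩
    rw [← Finset.card_image_iff]
    have : D.cells.image (fun c : ℕ × ℕ => f c.1 c.2) = Finset.Icc 1 D.card := by
      ext v
      rw [Finset.mem_image, hmem, Finset.mem_Icc]
    rw [this]
    simp
  · intro h
    refine List.perm_range'_of_mem_iff ?_ fun v hv hv' => mem_flatten_fillingRows.2 ?_
    · rw [List.length_flatten, map_length_fillingRows, YoungDiagram.card_eq_sum_rowLens]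
    · exact h.surjOn ⟨hv, hv'⟩

theorem isTableau_fillingRows {D : YoungDiagram} (T : SemistandardYoungTableau D) :
    IsTableau (fillingRows D T) := by
  rw [isTableau_iff]
  constructor
  · intro r hr
    obtain ⟨i, hi, rfl⟩ := List.mem_map.1 hr
    rw [List.mem_range, ← YoungDiagram.mem_iff_lt_colLen] at hi
    constructor
    · have := YoungDiagram.mem_iff_lt_rowLen.1 hi
      simp only [ne_eq, List.map_eq_nil_iff, List.range_eq_nil]
      omega
    · rw [List.pairwise_iff_getElem]
      intro j₁ j₂ h₁ h₂ hlt
      simp only [List.getElem_map, List.getElem_range]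
      exact T.row_weak hlt (YoungDiagram.mem_iff_lt_rowLen.2 (by simpa using h₂))
  · rw [fillingRows, List.pairwise_map]
    refine List.pairwise_lt_range.imp fun {i₁ i₂} hlt => ?_
    rw [columnsLT_iff_getElem]
    refine ⟨by simpa using D.rowLen_anti i₁ i₂ hlt.le, fun j hj => ?_⟩
    simp only [List.getElem_map, List.getElem_range]
    exact T.col_strict hlt (YoungDiagram.mem_iff_lt_rowLen.2 (by simpa using hj))

theorem YoungDiagram.length_getD_eq_rowLen {D : YoungDiagram} {Q : List (List ℕ)}
    (hQ : Q.map List.length = D.rowLens) (i : ℕ) : (Q.getD i []).length = D.rowLen i := by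
  have hl : Q.length = D.colLen 0 := by
    rw [← YoungDiagram.length_rowLens, ← hQ, List.length_map]
  by_cases hi : i < Q.length
  · have : D.rowLens[i]'(by rw [← hQ]; simpa) = D.rowLen i := YoungDiagram.get_rowLens
    simp only [← hQ, List.getElem_map] at this
    simpa [hi] using this
  · rw [YoungDiagram.rowLen_eq_zero (by omega)]
    simp [not_lt.1 hi]

/-- The semistandard filling given by a list of rows. -/
def IsTableau.toSemistandard {D : YoungDiagram} {Q : List (List ℕ)} (hT : IsTableau Q)
    (hQ : Q.map List.length = D.rowLens) : SemistandardYoungTableau D where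
  entry i j := (Q.getD i []).getD j 0
  row_weak' {i j₁ j₂} hlt hmem := by
    rw [YoungDiagram.mem_iff_lt_rowLen, ← YoungDiagram.length_getD_eq_rowLen hQ] at hmem
    have hi : i < Q.length := by
      by_contra hi
      simp [not_lt.1 hi] at hmem
    have hr := ((isTableau_iff.1 hT).1 Q[i] (List.getElem_mem hi)).2
    simp only [List.getD_eq_getElem _ _ hi] at hmem ⊢
    rw [List.getD_eq_getElem _ _ hmem, List.getD_eq_getElem _ _ (hlt.trans hmem)]
    exact List.pairwise_iff_getElem.1 hr j₁ j₂ _ _ hlt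
  col_strict' {i₁ i₂ j} hlt hmem := by
    rw [YoungDiagram.mem_iff_lt_rowLen, ← YoungDiagram.length_getD_eq_rowLen hQ] at hmem
    have hi : i₂ < Q.length := by
      by_contra hi
      simp [not_lt.1 hi] at hmem
    obtain ⟨hl, hc⟩ := columnsLT_iff_getElem.1
      (List.pairwise_iff_getElem.1 (isTableau_iff.1 hT).2 i₁ i₂ (hlt.trans hi) hi hlt)
    simp only [List.getD_eq_getElem _ _ hi, List.getD_eq_getElem _ _ (hlt.trans hi)] at hmem ⊢
    rw [List.getD_eq_getElem _ _ hmem, List.getD_eq_getElem _ _ (hmem.trans_le hl)]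
    exact hc j hmem
  zeros' {i j} hmem := by
    rw [YoungDiagram.mem_iff_lt_rowLen, ← YoungDiagram.length_getD_eq_rowLen hQ, not_lt] at hmem
    exact List.getD_eq_default _ _ hmem

theorem fillingRows_getD {D : YoungDiagram} {Q : List (List ℕ)}
    (hQ : Q.map List.length = D.rowLens) :
    fillingRows D (fun i j => (Q.getD i []).getD j 0) = Q := by
  have hl : Q.length = D.colLen 0 := by
    rw [← YoungDiagram.length_rowLens, ← hQ, List.length_map]
  refine List.ext_getElem (by simp [fillingRows, hl]) fun i h₁ h₂ => ?_
  have hlen := YoungDiagram.length_getD_eq_rowLen hQ i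
  rw [List.getD_eq_getElem _ _ h₂] at hlen
  refine List.ext_getElem (by simp [fillingRows, hlen]) fun j h₃ h₄ => ?_
  simp [fillingRows, h₂, h₄]

theorem card_standardYoungTableau (D : YoungDiagram) :
    Nat.card (StandardYoungTableau D) = Nat.card (ListStandardTableau D) := by
  refine Nat.card_eq_of_bijective (fun T : StandardYoungTableau D =>
    (⟨fillingRows D T.1, isTableau_fillingRows T.1, map_length_fillingRows D _,
      flatten_fillingRows_perm_iff.2 T.2⟩ : ListStandardTableau D)) ⟨fun T T' h => ?_, ?_⟩
  · have h' : fillingRows D T.1 = fillingRows D T'.1 := congrArg Subtype.val h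
    refine Subtype.ext (SemistandardYoungTableau.ext fun i j => ?_)
    rw [← getD_fillingRows (fun _ _ => T.1.zeros) i j, h',
      getD_fillingRows (fun _ _ => T'.1.zeros) i j]
  · rintro ⟨Q, hT, hQ, hp⟩
    have hrows : fillingRows D (hT.toSemistandard hQ) = Q := fillingRows_getD hQ
    exact ⟨⟨hT.toSemistandard hQ, flatten_fillingRows_perm_iff.1 (by rwa [hrows])⟩,
      Subtype.ext hrows⟩

end StandardTableaux

/-! ### Permutations of a given shape -/

section PermutationsOfShape

open scoped List

variable {α β : Type*} [LinearOrder α] [LinearOrder β]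

theorem rowInsert_map {f : α → β} (hf : StrictMono f) (x : α) (r : List α) :
    rowInsert (f x) (r.map f) = ((rowInsert x r).1.map f, (rowInsert x r).2.map f) := by
  induction r with
  | nil => simp [rowInsert]
  | cons a r ih =>
    simp only [List.map_cons, rowInsert, hf.lt_iff_lt, ih]
    split_ifs <;> simp

theorem tableauInsert_map {f : α → β} (hf : StrictMono f) (x : α) (T : List (List α)) :
    tableauInsert (f x) (T.map (List.map f)) = (tableauInsert x T).map (List.map f) := by
  induction T generalizing x with
  | nil => simp [tableauInsert]
  | cons r rs ih =>
    rw [List.map_cons, tableauInsert, tableauInsert, rowInsert_map hf]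
    rcases (rowInsert x r).2 with _ | y <;> simp [ih]

theorem rsTableau_map {f : α → β} (hf : StrictMono f) (l : List α) :
    rsTableau (l.map f) = (rsTableau l).map (List.map f) := by
  induction l using List.reverseRecOn with
  | nil => simp [rsTableau]
  | append_singleton l x ih =>
    rw [List.map_append, List.map_singleton, rsTableau_append_singleton,
      rsTableau_append_singleton, ih, tableauInsert_map hf]

variable {n : ℕ}

theorem Nat.Partition.rowLens_youngDiagram (lam : n.Partition) :
    lam.youngDiagram.rowLens = lam.parts.sort (· ≥ ·) :=
  YoungDiagram.rowLens_ofRowLens_eq_self fun _ hx => lam.parts_pos ((Multiset.mem_sort _).1 hx)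

theorem Nat.Partition.card_youngDiagram (lam : n.Partition) : lam.youngDiagram.card = n := by
  rw [YoungDiagram.card_eq_sum_rowLens, lam.rowLens_youngDiagram, ← Multiset.sum_coe,
    Multiset.sort_eq, lam.parts_sum]

theorem rsShape_eq_iff {p : Equiv.Perm (Fin n)} {lam : n.Partition} :
    rsShape p = lam ↔ (rsTableau (oneLine p)).map List.length = lam.youngDiagram.rowLens := by
  have hT := isTableau_rsTableau (oneLine p)
  have hparts : (rsShape p).parts = ((rsTableau (oneLine p)).map List.length : List ℕ) :=
    Multiset.filter_eq_self.2 fun a ha =>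
      (hT.pos_of_mem_map_length a (Multiset.mem_coe.1 ha)).ne'
  rw [lam.rowLens_youngDiagram, Nat.Partition.ext_iff, hparts]
  constructor
  · intro h
    rw [← h]
    refine List.Perm.eq_of_pairwise' hT.pairwise_map_length (Multiset.pairwise_sort _ _) ?_
    rw [← Multiset.coe_eq_coe, Multiset.sort_eq]
  · intro h
    rw [h, Multiset.sort_eq]

theorem Nat.Partition.firstColumn_rsShape (p : Equiv.Perm (Fin n)) :
    (rsShape p).firstColumn = dsPasses (oneLine p) := by
  have hnd : (oneLine p).Nodup := List.nodup_ofFn.2 p.injective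
  rw [← length_rsTableau_eq_dsPasses hnd, Nat.Partition.firstColumn,
    ← YoungDiagram.length_rowLens, ← rsShape_eq_iff.1 rfl, List.length_map]

/-- The one-line notation of a permutation, with entries `1, …, n`. -/
def oneLineSucc (p : Equiv.Perm (Fin n)) : List ℕ :=
  (oneLine p).map fun i => i.val + 1

theorem oneLineSucc_injective : Function.Injective (oneLineSucc (n := n)) := by
  intro p q h
  have h' : oneLine p = oneLine q :=
    List.map_injective_iff.2 (fun i j hij => Fin.ext (Nat.succ_injective hij)) h
  exact Equiv.ext fun i => congrFun (List.ofFn_injective h') i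

theorem oneLineSucc_perm (p : Equiv.Perm (Fin n)) : oneLineSucc p ~ List.range' 1 n := by
  refine List.perm_range'_of_mem_iff (by simp [oneLineSucc, oneLine]) fun v hv hv' => ?_
  refine List.mem_map.2 ⟨⟨v - 1, by omega⟩, ?_, by simp; omega⟩
  exact List.mem_ofFn.2 (p.surjective _)

theorem exists_oneLineSucc_eq {l : List ℕ} (hl : l ~ List.range' 1 n) :
    ∃ p : Equiv.Perm (Fin n), oneLineSucc p = l := by
  have hlen : l.length = n := by simpa using hl.length_eq
  have hmem : ∀ (i : ℕ) (hi : i < l.length), 1 ≤ l[i] ∧ l[i] < 1 + n := fun i hi =>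
    List.mem_range'_1.1 (hl.subset (List.getElem_mem hi))
  have hnd : l.Nodup := hl.nodup_iff.2 List.nodup_range'
  let f : Fin n → Fin n := fun i =>
    ⟨l[i.val]'(by omega) - 1, by have := hmem i.val (by omega); omega⟩
  have hf : Function.Injective f := by
    intro i j hij
    have h1 := hmem i.val (by omega)
    have h2 := hmem j.val (by omega)
    have h3 : l[i.val]'(by omega) - 1 = l[j.val]'(by omega) - 1 := congrArg Fin.val hij
    exact Fin.ext ((hnd.getElem_inj_iff).1 (by omega))
  refine ⟨Equiv.ofBijective f (Finite.injective_iff_bijective.1 hf), ?_⟩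
  refine List.ext_getElem (by simp [oneLineSucc, oneLine, hlen]) fun i h₁ h₂ => ?_
  have := hmem i h₂
  simp only [oneLineSucc, oneLine, List.getElem_map, List.getElem_ofFn, Equiv.ofBijective_apply, f]
  omega

theorem map_length_rsTableau_oneLineSucc (p : Equiv.Perm (Fin n)) :
    (rsTableau (oneLineSucc p)).map List.length = (rsTableau (oneLine p)).map List.length := by
  rw [oneLineSucc, rsTableau_map fun i j hij => by simpa using hij]
  simp

theorem card_rsShape_eq (lam : n.Partition) :
    Nat.card {p : Equiv.Perm (Fin n) // rsShape p = lam} = lam.numSYT ^ 2 := by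
  rw [Nat.Partition.numSYT, card_standardYoungTableau, sq, ← Nat.card_prod]
  have hshape : ∀ p : {p : Equiv.Perm (Fin n) // rsShape p = lam},
      (rsTableau (oneLineSucc p.1)).map List.length = lam.youngDiagram.rowLens := fun p =>
    (map_length_rsTableau_oneLineSucc p.1).trans (rsShape_eq_iff.1 p.2)
  have hperm := fun p : Equiv.Perm (Fin n) => oneLineSucc_perm p
  have hlen : ∀ p : Equiv.Perm (Fin n), (oneLineSucc p).length = lam.youngDiagram.card :=
    fun p => by rw [(hperm p).length_eq, lam.card_youngDiagram]; simp
  refine Nat.card_eq_of_bijective (fun p =>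
    ((⟨rsTableau (oneLineSucc p.1), isTableau_rsTableau _, hshape p,
        (flatten_rsTableau_perm _).trans (by rw [lam.card_youngDiagram]; exact hperm p.1)⟩,
      ⟨rsRecording (oneLineSucc p.1), isTableau_rsRecording _,
        (map_length_rsRecording _).trans (hshape p),
        hlen p.1 ▸ flatten_rsRecording_perm _⟩) :
      ListStandardTableau lam.youngDiagram × ListStandardTableau lam.youngDiagram)) ⟨?_, ?_⟩
  · intro p q h
    obtain ⟨h₁, h₂⟩ := Prod.mk.inj h
    exact Subtype.ext (oneLineSucc_injective
      (rsTableau_rsRecording_injective (congrArg Subtype.val h₁) (congrArg Subtype.val h₂)))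
  · rintro ⟨⟨P, hP, hPs, hPp⟩, ⟨Q, hQ, hQs, hQp⟩⟩
    obtain ⟨l, hlP, hlQ⟩ := exists_rsTableau_rsRecording_eq hP hQ (hPs.trans hQs.symm) hQp
    have hl : l ~ List.range' 1 n := by
      rw [← hlP, lam.card_youngDiagram] at hPp
      exact (flatten_rsTableau_perm l).symm.trans hPp
    obtain ⟨p, rfl⟩ := exists_oneLineSucc_eq hl
    refine ⟨⟨p, ?_⟩, Prod.ext (Subtype.ext hlP) (Subtype.ext hlQ)⟩
    rw [rsShape_eq_iff, ← map_length_rsTableau_oneLineSucc, hlP, hPs]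

end PermutationsOfShape

/-! ### The law of the shape -/

section Law

variable {n : ℕ}

theorem uniformPerm_rsShape_eq (lam : n.Partition) :
    uniformPerm n {p | rsShape p = lam} =
      ENNReal.ofReal ((lam.numSYT : ℝ) ^ 2 / (n.factorial : ℝ)) := by
  classical
  have hcard : Fintype.card {p : Equiv.Perm (Fin n) | rsShape p = lam} = lam.numSYT ^ 2 := by
    rw [← card_rsShape_eq lam, Nat.card_eq_fintype_card]
    rfl
  rw [uniformPerm, PMF.toMeasure_uniformOfFintype_apply _ MeasurableSpace.measurableSet_top, hcard,
    Fintype.card_perm, Fintype.card_fin,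
    ENNReal.ofReal_div_of_pos (by exact_mod_cast n.factorial_pos)]
  norm_cast

theorem plancherel_singleton (lam : n.Partition) :
    plancherel n {lam} = ENNReal.ofReal ((lam.numSYT : ℝ) ^ 2 / (n.factorial : ℝ)) := by
  classical
  rw [plancherel, Measure.coe_finsetSum, Finset.sum_apply, Finset.sum_eq_single lam]
  · simp
  · intro mu _ hmu
    simp [hmu]
  · simp

theorem hasLaw_rsShape_uniformPerm : HasLaw rsShape (plancherel n) (uniformPerm n) where
  aemeasurable := measurable_from_top.aemeasurable
  map_eq := by
    refine Measure.ext_of_singleton fun lam => ?_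
    rw [Measure.map_apply measurable_from_top MeasurableSpace.measurableSet_top,
      plancherel_singleton, ← uniformPerm_rsShape_eq]
    rfl

end Law

theorem mainTheorem4 (n : ℕ) {Ω : Type*} [MeasurableSpace Ω] (P : Measure Ω)
    [IsProbabilityMeasure P] (p : Ω → Equiv.Perm (Fin n)) (hp : HasLaw p (uniformPerm n) P) :
    -- the Robinson-Schensted shape of `p` is a Plancherel-random partition of `n`
    HasLaw (fun ω => rsShape (p ω)) (plancherel n) P ∧
    -- the number of passes and the first-column length have (finite) expectations
    Integrable (fun ω => (dsPasses (oneLine (p ω)) : ℝ)) P ∧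
    Integrable (fun ω => ((rsShape (p ω)).firstColumn : ℝ)) P ∧
    -- the chain of equalities for the expected number of passes
    ∫ ω, (dsPasses (oneLine (p ω)) : ℝ) ∂P =
      ∑ lam : n.Partition, (lam.firstColumn : ℝ) * P.real {ω | rsShape (p ω) = lam} ∧
    ∫ ω, (dsPasses (oneLine (p ω)) : ℝ) ∂P =
      ∑ lam : n.Partition,
        (lam.firstColumn : ℝ) * ((lam.numSYT : ℝ) ^ 2 / (n.factorial : ℝ)) ∧
    ∫ ω, (dsPasses (oneLine (p ω)) : ℝ) ∂P =
      ∫ ω, ((rsShape (p ω)).firstColumn : ℝ) ∂P ∧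
    ∫ ω, (dsPasses (oneLine (p ω)) : ℝ) ∂P =
      ∫ lam : n.Partition, (lam.firstColumn : ℝ) ∂(plancherel n) := by
  have hlaw : HasLaw (fun ω => rsShape (p ω)) (plancherel n) P :=
    hasLaw_rsShape_uniformPerm.fun_comp hp
  have : IsProbabilityMeasure (plancherel n) := hlaw.isProbabilityMeasure_iff.1 inferInstance
  have hint : Integrable (fun lam : n.Partition => (lam.firstColumn : ℝ)) (plancherel n) :=
    Integrable.of_finite
  have hint' : Integrable (fun ω => ((rsShape (p ω)).firstColumn : ℝ)) P := by
    rw [← hlaw.map_eq] at hint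
    exact hint.comp_aemeasurable hlaw.aemeasurable
  have hE : ∫ ω, ((rsShape (p ω)).firstColumn : ℝ) ∂P =
      ∫ lam : n.Partition, (lam.firstColumn : ℝ) ∂(plancherel n) :=
    hlaw.integral_comp hint.aestronglyMeasurable
  have hreal : ∀ lam : n.Partition, (plancherel n).real {lam} =
      (lam.numSYT : ℝ) ^ 2 / (n.factorial : ℝ) := fun lam => by
    rw [measureReal_def, plancherel_singleton, ENNReal.toReal_ofReal (by positivity)]
  have hsum : ∫ lam : n.Partition, (lam.firstColumn : ℝ) ∂(plancherel n) =
      ∑ lam : n.Partition,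
        (lam.firstColumn : ℝ) * ((lam.numSYT : ℝ) ^ 2 / (n.factorial : ℝ)) := by
    rw [integral_fintype hint]
    exact Finset.sum_congr rfl fun lam _ => by rw [hreal, smul_eq_mul, mul_comm]
  have hP : ∀ lam : n.Partition, P.real {ω | rsShape (p ω) = lam} =
      (lam.numSYT : ℝ) ^ 2 / (n.factorial : ℝ) := fun lam => by
    rw [hlaw.measureReal_eq (p := fun mu => mu = lam) MeasurableSpace.measurableSet_top, ← hreal]
    rfl
  simp only [← Nat.Partition.firstColumn_rsShape, hP]
  exact ⟨hlaw, hint', hint', hE.trans hsum, hE.trans hsum, trivial, hE⟩
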